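/- **Theorem (Fluctuations in the Euler regime).** A point $(x,v,r)\in\mathbb R^3$ represents a particle at position $x$ at time $0$, with velocity $v$ and mark (rod length) $r$; its space-time line is $\ell(x,v)=\{(x+vt,t):t\in\mathbb R\}$. For $a,b\in\mathbb R^2$ let $ab$ be the set of $(x,v,r)$ such that $\ell(x,v)$ meets the closed segment with extremes $a$ and $b$. Let $\mu$ be a Borel measure on $\mathbb R^3$, let $d\mu_2(x,v,r)=r^2\,d\mu(x,v,r)$, and assume $\mu(ab)+\mu_2(ab)<\infty$ for all $a,b\in\mathbb R^2$. Put $\mathrm d(a,b)=\mu_2(ab)$ and assume $\mathrm d(a,a)=0$ for every $a\in\mathbb R^2$. For a measure $\nu$ on $\mathbb R^3$ let $$m_0^x(\nu)=\iiint r'\bigl(\mathbf 1\{0\le x'<x\}-\mathbf 1\{x\le x'<0\}\bigr)\,d\nu(x',v',r'),$$ $$j_\nu(x,v;t)=\iiint r'\bigl(\mathbf 1\{x'>x,\;x'+tv'<x+vt\}-\mathbf 1\{x'<x,\;x'+tv'>x+vt\}\bigr)\,d\nu(x',v',r'),$$ $$y_\nu(x,v;t)=x+m_0^x(\nu)+vt+j_\nu(x,v;t),$$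 and let $\nu_t$ be the image of $\nu$ under $(x,v,r)\mapsto(x+vt,v,r)$. Thus, when $\nu$ is the empirical measure of a configuration, $y_\nu(x,v;t)$ is the position at time $t$ of the tagged hard-rod quasi-particle with velocity $v$ started at $x+m_0^x(\nu)$. For $\varepsilon>0$ let $N[X^\varepsilon]=\sum_{p\in X^\varepsilon}\delta_p$ be the empirical measure of a Poisson process $X^\varepsilon$ with intensity measure $\varepsilon^{-1}\mu$, and let $N^\varepsilon=\varepsilon N[X^\varepsilon]$. Let $\eta$ be the Lévy–Chentsov field (multitime Brownian field) with distance $\mathrm d$, that is, the centered Gaussian process $(\eta(a))_{a\in\mathbb R^2}$ with covariances $\mathrm{Cov}(\eta(a),\eta(b))=\tfrac12\bigl(\mathrm d(o,a)+\mathrm d(o,b)-\mathrm d(a,b)\bigr)$, where $o=(0,0)$. Then, as $\varepsilon\to0$, $$\varepsilon^{-1/2}\bigl(y_{N^\varepsilon}(x,v;t)-y_\mu(x,v;t)\bigr)\;\longrightarrow\;\eta(x+vt,t),$$ $$\varepsilon^{-1/2}\bigl(\varepsilon\, m_0^x(N[X^\varepsilon]_t)-m_0^x(\mu_t)\bigr)\;\longrightarrow\;\eta(x,t)-\eta(0,t)$$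 jointly in law, in the sense of finite-dimensional distributions: for every finite family of triples $(x_i,v_i,t_i)$ and every finite family of pairs $(z_k,s_k)$, the random vector formed by the left-hand sides of the first display at the $(x_i,v_i,t_i)$ and of the second display at $(x,t)=(z_k,s_k)$ converges in law to the vector formed by the corresponding right-hand sides, all of them taken from the same field $\eta$. -/

import Mathlib

open MeasureTheory ProbabilityTheory Filter Topology
open scoped ENNReal NNReal

noncomputable section

namespace HardRod

/-- A point `(x, v, r)`: a particle at position `x` at time `0`, with velocity `v`, carrying the
mark (rod length) `r`. -/
abbrev Particle : Type := ℝ × ℝ × ℝ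

/-- The space-time line `ℓ(x, v) = {(x + v t, t) : t ∈ ℝ}`. -/
def line (x v : ℝ) : Set (ℝ × ℝ) := Set.range fun t : ℝ => (x + v * t, t)

/-- The set `ab` of points `(x, v, r)` whose line `ℓ(x, v)` meets the closed segment with
extremes `a` and `b`. -/
def crossing (a b : ℝ × ℝ) : Set Particle :=
  {p | (line p.1 p.2.1 ∩ segment ℝ a b).Nonempty}

/-- The measure `dμ₂ = r² dμ`. -/
def secondMark (μ : Measure Particle) : Measure Particle :=
  μ.withDensity fun p => ENNReal.ofReal (p.2.2 ^ 2)

/-- The class `𝓜` of measures with `μ(ab) + μ₂(ab) < ∞` for all space-time points `a, b`. -/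
def IsAdmissible (μ : Measure Particle) : Prop :=
  ∀ a b : ℝ × ℝ, μ (crossing a b) + secondMark μ (crossing a b) < ∞

/-- `d(a, b) = μ₂(ab)`. -/
def crossingDist (μ : Measure Particle) (a b : ℝ × ℝ) : ℝ :=
  (secondMark μ (crossing a b)).toReal

/-- The measure `N[X] = ∑_{p ∈ X} δ_p` of an at most countable configuration `X` of points
(possibly repeated). -/
def IsEmpiricalMeasure (ν : Measure Particle) : Prop :=
  ∃ (ι : Type) (_ : Countable ι) (X : ι → Particle), ν = Measure.sum fun i => Measure.dirac (X i)

/-- `N` is the empirical measure of a Poisson process with intensity measure `Λ`. -/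
structure IsPoissonProcess {Ω : Type*} [MeasurableSpace Ω] (N : Ω → Measure Particle)
    (Λ : Measure Particle) (P : Measure Ω) : Prop where
  measurable : Measurable N
  isEmpiricalMeasure : ∀ ω, IsEmpiricalMeasure (N ω)
  map_eq : ∀ A : Set Particle, MeasurableSet A → Λ A < ∞ →
    P.map (fun ω => N ω A) = (poissonMeasure (Λ A).toNNReal).map (Nat.cast : ℕ → ℝ≥0∞)
  indep : ∀ (n : ℕ) (A : Fin n → Set Particle), (∀ i, MeasurableSet (A i)) →
    Pairwise (Function.onFun Disjoint A) → iIndepFun (fun i ω => N ω (A i)) P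

/-- The rescaled empirical measure `N^ε φ = ε ∑_{p ∈ X^ε} φ(p)`, where `N` is the empirical measure
of `X^ε`. -/
def rescale (ε : ℝ) (N : Measure Particle) : Measure Particle := ENNReal.ofReal ε • N

/-- The free (ideal gas) motion `(x, v, r) ↦ (x + v t, v, r)`. -/
def freeMotion (t : ℝ) (p : Particle) : Particle := (p.1 + p.2.1 * t, p.2.1, p.2.2)

/-- The ideal gas at time `t`: the measure `ν_t`, image of `ν` under the free motion. For an
empirical measure `N[X]` it is the empirical measure of `T_t X`. -/
def evolve (t : ℝ) (ν : Measure Particle) : Measure Particle := ν.map (freeMotion t)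

/-- The signed length
`m_z^x(ν) = ∫ r (1{z ≤ x' < x} - 1{x ≤ x' < z}) dν(x', v', r)` between `z` and `x`. -/
def mass (ν : Measure Particle) (z x : ℝ) : ℝ :=
  ∫ p, p.2.2 * ((Set.Ico z x).indicator 1 p.1 - (Set.Ico x z).indicator 1 p.1) ∂ν

/-- The length flow `j_ν(x, v; t)` across the line `ℓ(x, v)` between times `0` and `t`:
`∫ r' (1{x' > x, x' + t v' < x + v t} - 1{x' < x, x' + t v' > x + v t}) dν(x', v', r')`. -/
def flow (ν : Measure Particle) (x v t : ℝ) : ℝ :=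
  ∫ p, p.2.2 *
    (Set.indicator {q : Particle | x < q.1 ∧ q.1 + t * q.2.1 < x + v * t} 1 p -
      Set.indicator {q : Particle | q.1 < x ∧ x + v * t < q.1 + t * q.2.1} 1 p) ∂ν

/-- The position at time `t` of the tagged quasi-particle started at `x + m_0^x(ν)` with
velocity `v`: `y_ν(x, v; t) = x + m_0^x(ν) + v t + j_ν(x, v; t)`. -/
def quasiParticle (ν : Measure Particle) (x v t : ℝ) : ℝ :=
  x + mass ν 0 x + v * t + flow ν x v t

/-- `η` is a Lévy–Chentsov field (multitime Brownian field) with distance `d`: a centered Gaussian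
process on the space-time plane with
`Cov(η(a), η(b)) = (d(o, a) + d(o, b) - d(a, b)) / 2`, `o` being the origin. -/
structure IsLevyChentsovField {Ω : Type*} [MeasurableSpace Ω] (η : ℝ × ℝ → Ω → ℝ)
    (d : ℝ × ℝ → ℝ × ℝ → ℝ) (P : Measure Ω) : Prop where
  isGaussianProcess : IsGaussianProcess η P
  centered : ∀ a, ∫ ω, η a ω ∂P = 0
  covariance_eq : ∀ a b, cov[η a, η b; P] = (d 0 a + d 0 b - d a b) / 2

end HardRod

end

open HardRod

/-!
Every quantity in the theorem is a linear functional `ν ↦ ∫ signedMark o a dν` of the measure: the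
tagged position `y_ν(x, v; t)` is `x + v t` plus the signed length of the lines separating the
origin from `(x + v t, t)`, and `m_0^z(ν_s)` is the difference of these signed lengths at `(z, s)`
and `(0, s)`. For a Poisson process the characteristic function of such functionals is explicit,
and the expansion `e^{ix} - 1 - ix ~ -x²/2` turns it, as `ε → 0`, into that of a centered Gaussian
vector with covariance `∫ signedMark o a * signedMark o b dμ`. Since `d(a, b)` is the integral of
`(signedMark a b)²` and `signedMark a b = signedMark o b - signedMark o a`, polarisation identifies
this covariance with that of the Lévy–Chentsov field.
-/

namespace HardRod

section CharacteristicFunctions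

variable {K : Type*} [Fintype K] {Ω' : Type*} [MeasurableSpace Ω'] {Q : Measure Ω'}
  {Y : Ω' → K → ℝ}

lemma charFun_map_toLp (hY : AEMeasurable Y Q) (w : EuclideanSpace ℝ K) :
    charFun (Q.map fun ω => WithLp.toLp 2 (Y ω)) w
      = ∫ ω, Complex.exp ((∑ k, w k * Y ω k : ℝ) * Complex.I) ∂Q := by
  rw [charFun_apply, integral_map (by fun_prop) (by fun_prop)]
  simp only [PiLp.inner_apply, Real.inner_apply, mul_comm]

lemma tendstoInDistribution_of_tendsto_integral_cexp {T : Type*} {l : Filter T}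
    [l.IsCountablyGenerated] {Ω : T → Type*} [∀ i, MeasurableSpace (Ω i)]
    {P : ∀ i, Measure (Ω i)} [∀ i, IsProbabilityMeasure (P i)] [IsProbabilityMeasure Q]
    {X : ∀ i, Ω i → K → ℝ} (hX : ∀ i, AEMeasurable (X i) (P i)) (hY : AEMeasurable Y Q)
    (h : ∀ w : K → ℝ, Tendsto
      (fun i => ∫ ω, Complex.exp ((∑ k, w k * X i ω k : ℝ) * Complex.I) ∂P i) l
      (𝓝 (∫ ω, Complex.exp ((∑ k, w k * Y ω k : ℝ) * Complex.I) ∂Q))) :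
    TendstoInDistribution X l Y P Q := by
  have hE : TendstoInDistribution (fun i ω => WithLp.toLp 2 (X i ω)) l
      (fun ω => WithLp.toLp 2 (Y ω)) P Q :=
    { forall_aemeasurable := fun i => by fun_prop
      aemeasurable_limit := by fun_prop
      tendsto := by
        refine tendsto_of_seq_tendsto fun u hu => ?_
        refine ProbabilityMeasure.tendsto_of_tendsto_charFun fun w => ?_
        rw [ProbabilityMeasure.coe_mk, charFun_map_toLp hY]
        exact ((h w).comp hu).congr fun n => (charFun_map_toLp (hX (u n)) w).symm }
  exact hE.continuous_comp (PiLp.continuous_ofLp 2 _)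

end CharacteristicFunctions

section ExponentialRemainder

/-- The remainder `e^{ix} - 1 - ix` of the first-order expansion of the exponential, the exponent
of the characteristic function of a compensated Poisson integral. -/
noncomputable def cexpRemainder (x : ℝ) : ℂ := Complex.exp (x * Complex.I) - 1 - x * Complex.I

lemma norm_cexp_mul_I_sub_one_le (x : ℝ) : ‖Complex.exp (x * Complex.I) - 1‖ ≤ |x| := by
  rw [mul_comm]
  exact Real.norm_exp_I_mul_ofReal_sub_one_le

@[fun_prop]
lemma continuous_cexpRemainder : Continuous cexpRemainder := by
  unfold cexpRemainder
  fun_prop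

lemma norm_cexpRemainder_le (x : ℝ) : ‖cexpRemainder x‖ ≤ 2 * x ^ 2 := by
  have hn : ‖(x : ℂ) * Complex.I‖ = |x| := by simp
  rcases le_total |x| 1 with h | h
  · have hsmall := Complex.norm_exp_sub_one_sub_id_le (hn.le.trans h)
    rw [hn, sq_abs] at hsmall
    exact hsmall.trans (by linarith [sq_nonneg x])
  · calc ‖cexpRemainder x‖ ≤ |x| + |x| :=
          (norm_sub_le _ _).trans (add_le_add (norm_cexp_mul_I_sub_one_le x) hn.le)
      _ ≤ 2 * x ^ 2 := by rw [← sq_abs]; nlinarith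

lemma isLittleO_cexpRemainder_add_sq_div_two :
    (fun x : ℝ => cexpRemainder x + x ^ 2 / 2) =o[𝓝 0] fun x : ℝ => x ^ 2 := by
  have h0 : Tendsto (fun x : ℝ => (x : ℂ) * Complex.I) (𝓝 0) (𝓝 0) :=
    Continuous.tendsto' (by fun_prop) _ _ (by simp)
  refine ((Complex.exp_sub_sum_range_succ_isLittleO_pow 2).comp_tendsto h0).congr_left
    (fun x => ?_) |>.trans_isBigO (.of_norm_left ?_)
  · simp only [Function.comp_apply, cexpRemainder, Finset.sum_range_succ, Finset.sum_range_zero,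
      mul_pow, Complex.I_sq, Nat.factorial]
    push_cast
    ring
  · simpa using Asymptotics.isBigO_refl (fun x : ℝ => x ^ 2) (𝓝 0)

lemma tendsto_cexpRemainder_sqrt_mul_div (y : ℝ) :
    Tendsto (fun ε : ℝ => cexpRemainder (√ε * y) / ε) (𝓝[>] 0) (𝓝 (-(y ^ 2 : ℝ) / 2)) := by
  have h0 : Tendsto (fun ε : ℝ => √ε * y) (𝓝[>] 0) (𝓝 0) :=
    tendsto_nhdsWithin_of_tendsto_nhds (Continuous.tendsto' (by fun_prop) _ _ (by simp))
  have hO : (fun ε : ℝ => (√ε * y) ^ 2) =O[𝓝[>] 0] fun ε : ℝ => (ε : ℂ) := by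
    refine .of_bound (y ^ 2) ?_
    filter_upwards [self_mem_nhdsWithin] with ε (hε : 0 < ε)
    simp [mul_pow, Real.sq_sqrt hε.le, abs_of_pos hε, mul_comm]
  have hlim := ((isLittleO_cexpRemainder_add_sq_div_two.comp_tendsto h0).trans_isBigO
    hO).tendsto_div_nhds_zero
  rw [← zero_add (-_ / 2)]
  refine (hlim.add_const _).congr' ?_
  filter_upwards [self_mem_nhdsWithin] with ε (hε : 0 < ε)
  have hε' : (ε : ℂ) ≠ 0 := by exact_mod_cast hε.ne'
  have hsq : ((√ε : ℝ) : ℂ) ^ 2 = ε := by exact_mod_cast Real.sq_sqrt hε.le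
  simp only [Function.comp_apply, Complex.ofReal_mul, Complex.ofReal_pow, mul_pow, hsq]
  field_simp
  ring

lemma tendsto_integral_cexpRemainder_sqrt_mul_div {E : Type*} [MeasurableSpace E] {μ : Measure E}
    {F : E → ℝ} (hF : MemLp F 2 μ) :
    Tendsto (fun ε : ℝ => ∫ p, cexpRemainder (√ε * F p) / ε ∂μ) (𝓝[>] 0)
      (𝓝 (-((∫ p, F p ^ 2 ∂μ : ℝ) : ℂ) / 2)) := by
  have hlim : -((∫ p, F p ^ 2 ∂μ : ℝ) : ℂ) / 2 = ∫ p, -((F p ^ 2 : ℝ) : ℂ) / 2 ∂μ := by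
    rw [integral_div, integral_neg, integral_complex_ofReal]
  rw [hlim]
  have hFm := hF.aestronglyMeasurable.aemeasurable
  refine tendsto_integral_filter_of_dominated_convergence (fun p => 2 * F p ^ 2)
    (Eventually.of_forall fun ε => ?_) ?_ (hF.integrable_sq.const_mul 2)
    (ae_of_all _ fun p => tendsto_cexpRemainder_sqrt_mul_div (F p))
  · exact (by fun_prop : AEMeasurable _ μ).aestronglyMeasurable
  · filter_upwards [self_mem_nhdsWithin] with ε (hε : 0 < ε)
    refine ae_of_all _ fun p => ?_
    rw [norm_div, Complex.norm_real, Real.norm_of_nonneg hε.le, div_le_iff₀ hε]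
    refine (norm_cexpRemainder_le _).trans_eq ?_
    rw [mul_pow, Real.sq_sqrt hε.le]
    ring

end ExponentialRemainder

section PoissonRandomMeasures

lemma lintegral_natCast_poissonMeasure (r : ℝ≥0) :
    ∫⁻ n : ℕ, (n : ℝ≥0∞) ∂poissonMeasure r = r := by
  have succ_mul n : ((n + 1 : ℕ) : ℝ≥0∞) * poissonMeasure r {n + 1}
      = r * poissonMeasure r {n} := by
    rw [poissonMeasure_singleton, poissonMeasure_singleton, ← ENNReal.ofReal_natCast,
      ← ENNReal.ofReal_coe_nnreal, ← ENNReal.ofReal_mul (by positivity),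
      ← ENNReal.ofReal_mul (by positivity), Nat.factorial_succ, pow_succ]
    congr 1
    push_cast
    field_simp
  have total : ∑' n, poissonMeasure r {n} = 1 := by
    have h := lintegral_countable' (μ := poissonMeasure r) fun _ => 1
    simpa using h.symm
  rw [lintegral_countable', tsum_eq_zero_add' ENNReal.summable]
  simp only [succ_mul, ENNReal.tsum_mul_left, total, Nat.cast_zero, zero_mul, zero_add, mul_one]

/-- `N` is a Poisson random measure with intensity `Λ`: over measurable sets of finite intensity its
mass is Poisson distributed, and over disjoint sets its masses are independent. Unlike in
`IsPoissonProcess`, the space is arbitrary and `N ω` is not asked to be a sum of Dirac masses. -/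
structure IsPoissonRandomMeasure {E Ω : Type*} [MeasurableSpace E] [MeasurableSpace Ω]
    (N : Ω → Measure E) (Λ : Measure E) (P : Measure Ω) : Prop where
  measurable : Measurable N
  map_eq : ∀ A : Set E, MeasurableSet A → Λ A < ∞ →
    P.map (fun ω => N ω A) = (poissonMeasure (Λ A).toNNReal).map (Nat.cast : ℕ → ℝ≥0∞)
  indep : ∀ (n : ℕ) (A : Fin n → Set E), (∀ i, MeasurableSet (A i)) →
    Pairwise (Function.onFun Disjoint A) → iIndepFun (fun i ω => N ω (A i)) P

lemma IsPoissonProcess.isPoissonRandomMeasure {Ω : Type*} [MeasurableSpace Ω]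
    {N : Ω → Measure Particle} {Λ : Measure Particle} {P : Measure Ω}
    (h : IsPoissonProcess N Λ P) : IsPoissonRandomMeasure N Λ P :=
  ⟨h.measurable, h.map_eq, h.indep⟩

namespace IsPoissonRandomMeasure

variable {E Ω : Type*} [MeasurableSpace E] [MeasurableSpace Ω] {N : Ω → Measure E}
  {Λ : Measure E} {P : Measure Ω} {A : Set E} {F : E → ℝ}

lemma isProbabilityMeasure (h : IsPoissonRandomMeasure N Λ P) : IsProbabilityMeasure P := by
  have hmap := h.map_eq ∅ .empty (by simp)
  have : IsProbabilityMeasure (P.map fun ω => N ω ∅) := by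
    rw [hmap]
    exact Measure.isProbabilityMeasure_map (by fun_prop)
  exact Measure.isProbabilityMeasure_of_map (fun ω => N ω ∅)

lemma measurable_apply (h : IsPoissonRandomMeasure N Λ P) (hA : MeasurableSet A) :
    Measurable fun ω => N ω A :=
  (Measure.measurable_coe hA).comp h.measurable

lemma lintegral_apply (h : IsPoissonRandomMeasure N Λ P) (hA : MeasurableSet A)
    (hΛ : Λ A < ∞) : ∫⁻ ω, N ω A ∂P = Λ A :=
  calc ∫⁻ ω, N ω A ∂P = ∫⁻ x, x ∂(P.map fun ω => N ω A) :=
        (lintegral_map measurable_id (h.measurable_apply hA)).symm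
    _ = ∫⁻ n : ℕ, n ∂poissonMeasure (Λ A).toNNReal := by
        rw [h.map_eq A hA hΛ, lintegral_map (f := fun x => x) measurable_id .of_discrete]
    _ = Λ A := by rw [lintegral_natCast_poissonMeasure, ENNReal.coe_toNNReal hΛ.ne]

lemma bind_apply (h : IsPoissonRandomMeasure N Λ P) (hA : MeasurableSet A) (hΛ : Λ A < ∞) :
    P.bind N A = Λ A := by
  rw [Measure.bind_apply hA h.measurable.aemeasurable, h.lintegral_apply hA hΛ]

lemma bind_absolutelyContinuous (h : IsPoissonRandomMeasure N Λ P) : P.bind N ≪ Λ :=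
  Measure.AbsolutelyContinuous.mk fun A hA hΛ => by
    rw [h.bind_apply hA (hΛ.trans_lt ENNReal.zero_lt_top), hΛ]

lemma ae_ae (h : IsPoissonRandomMeasure N Λ P) {q : E → Prop} (hq : ∀ᵐ p ∂Λ, q p) :
    ∀ᵐ ω ∂P, ∀ᵐ p ∂N ω, q p :=
  Measure.ae_ae_of_ae_bind h.measurable.aemeasurable (h.bind_absolutelyContinuous.ae_le hq)

lemma restrict_bind (h : IsPoissonRandomMeasure N Λ P) {S : Set E} (hS : MeasurableSet S)
    [SigmaFinite (Λ.restrict S)] : (P.bind N).restrict S = Λ.restrict S := by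
  set s := spanningSets (Λ.restrict S)
  have hcover : S = ⋃ n, s n ∩ S := by
    rw [← Set.iUnion_inter, iUnion_spanningSets, Set.univ_inter]
  rw [hcover, Measure.restrict_iUnion_congr]
  intro n
  have hm : MeasurableSet (s n ∩ S) := (measurableSet_spanningSets _ n).inter hS
  have hfin : Λ (s n ∩ S) < ∞ := by
    rw [← Measure.restrict_apply (measurableSet_spanningSets _ n)]
    exact measure_spanningSets_lt_top _ n
  ext B hB
  rw [Measure.restrict_apply hB, Measure.restrict_apply hB,
    h.bind_apply (hB.inter hm) ((measure_mono Set.inter_subset_right).trans_lt hfin)]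

lemma integrable_bind (h : IsPoissonRandomMeasure N Λ P) (hF : Integrable F Λ) :
    Integrable F (P.bind N) := by
  have hfin := hF.aefinStronglyMeasurable
  have := hfin.sigmaFinite_restrict
  have hzero : ∀ᵐ p ∂(P.bind N), p ∉ hfin.sigmaFiniteSet → F p = 0 :=
    h.bind_absolutelyContinuous.ae_le
      ((ae_restrict_iff' hfin.measurableSet.compl).1 hfin.ae_eq_zero_compl)
  refine IntegrableOn.integrable_of_ae_notMem_eq_zero ?_ hzero
  rw [IntegrableOn, h.restrict_bind hfin.measurableSet]
  exact hF.restrict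

lemma ae_integrable (h : IsPoissonRandomMeasure N Λ P) (hF : Integrable F Λ) :
    ∀ᵐ ω ∂P, Integrable F (N ω) :=
  Measure.ae_integrable_of_integrable_comp (κ := ⟨N, h.measurable⟩) (h.integrable_bind hF)

lemma aemeasurable_integral (h : IsPoissonRandomMeasure N Λ P) (hF : Integrable F Λ) :
    AEMeasurable (fun ω => ∫ p, F p ∂N ω) P := by
  let κ : Kernel Ω E := ⟨N, h.measurable⟩
  refine ⟨fun ω => ∫ p, hF.1.mk F p ∂κ ω, ?_, ?_⟩
  · exact (hF.1.stronglyMeasurable_mk.integral_kernel).measurable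
  · filter_upwards [h.ae_ae hF.1.ae_eq_mk] with ω hω using integral_congr_ae hω

lemma integral_cexp_apply (h : IsPoissonRandomMeasure N Λ P) (hA : MeasurableSet A)
    (hΛ : Λ A < ∞) (c : ℝ) :
    ∫ ω, Complex.exp (((N ω).real A * c : ℝ) * Complex.I) ∂P
      = Complex.exp (Λ.real A * (Complex.exp (c * Complex.I) - 1)) :=
  calc ∫ ω, Complex.exp (((N ω).real A * c : ℝ) * Complex.I) ∂P
      = ∫ x, Complex.exp ((x.toReal * c : ℝ) * Complex.I) ∂(P.map fun ω => N ω A) :=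
        (integral_map (f := fun x : ℝ≥0∞ => Complex.exp ((x.toReal * c : ℝ) * Complex.I))
          (h.measurable_apply hA).aemeasurable (by fun_prop)).symm
    _ = charFun ((poissonMeasure (Λ A).toNNReal).map (Nat.cast : ℕ → ℝ)) c := by
        rw [h.map_eq A hA hΛ, charFun_apply_real, integral_map .of_discrete (by fun_prop),
          integral_map .of_discrete (by fun_prop)]
        simp only [ENNReal.toReal_natCast, mul_comm, Complex.ofReal_mul]
    _ = Complex.exp (Λ.real A * (Complex.exp (c * Complex.I) - 1)) :=
        charFun_map_cast_poissonMeasure ..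

lemma iIndepFun_apply {K : Type*} [Finite K] (h : IsPoissonRandomMeasure N Λ P) {A : K → Set E}
    (hA : ∀ k, MeasurableSet (A k)) (hdisj : Pairwise (Function.onFun Disjoint A)) :
    iIndepFun (fun k ω => N ω (A k)) P := by
  have := Fintype.ofFinite K
  let e := Fintype.equivFin K
  have hFin := h.indep _ (A ∘ e.symm) (fun i => hA _) (hdisj.comp_of_injective e.symm.injective)
  simpa using hFin.precomp e.injective

lemma integral_cexp_sum_apply {K : Type*} [Fintype K] (h : IsPoissonRandomMeasure N Λ P)
    {A : K → Set E} (hA : ∀ k, MeasurableSet (A k))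
    (hdisj : Pairwise (Function.onFun Disjoint A)) {c : K → ℝ} (hΛ : ∀ k, c k ≠ 0 → Λ (A k) < ∞) :
    ∫ ω, Complex.exp ((∑ k, (N ω).real (A k) * c k : ℝ) * Complex.I) ∂P
      = Complex.exp (∑ k, Λ.real (A k) * (Complex.exp (c k * Complex.I) - 1)) := by
  have := h.isProbabilityMeasure
  have hprod := (h.iIndepFun_apply hA hdisj).integral_fun_prod_comp (𝕜 := ℂ)
    (f := fun k x => Complex.exp ((x.toReal * c k : ℝ) * Complex.I))
    (fun k => (h.measurable_apply (hA k)).aemeasurable) (fun k => by fun_prop)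
  simp only [Complex.ofReal_sum, Finset.sum_mul, Complex.exp_sum]
  refine hprod.trans (Finset.prod_congr rfl fun k _ => ?_)
  by_cases hc : c k = 0
  · simp [hc]
  · exact h.integral_cexp_apply (hA k) (hΛ k hc) (c k)

lemma integral_cexp_integral_simpleFunc (h : IsPoissonRandomMeasure N Λ P)
    (f : SimpleFunc E ℝ) (hf : Integrable f Λ) :
    ∫ ω, Complex.exp ((∫ p, f p ∂N ω : ℝ) * Complex.I) ∂P
      = Complex.exp (∫ p, (Complex.exp (f p * Complex.I) - 1) ∂Λ) := by
  have hdisj : Pairwise (Function.onFun Disjoint fun y : f.range => f ⁻¹' {(y : ℝ)}) :=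
    fun y z hyz => Disjoint.preimage _ (Set.disjoint_singleton.2 (Subtype.coe_injective.ne hyz))
  have hN : ∀ᵐ ω ∂P, ∫ p, f p ∂N ω = ∑ y : f.range, (N ω).real (f ⁻¹' {(y : ℝ)}) * (y : ℝ) := by
    filter_upwards [h.ae_integrable hf] with ω hω
    rw [← SimpleFunc.integral_eq_integral f hω, SimpleFunc.integral_eq, ← Finset.sum_coe_sort]
    rfl
  have hΛ : ∫ p, (Complex.exp (f p * Complex.I) - 1) ∂Λ
      = ∑ y : f.range, Λ.real (f ⁻¹' {(y : ℝ)}) * (Complex.exp ((y : ℝ) * Complex.I) - 1) := by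
    have hg : Integrable (f.map fun y : ℝ => Complex.exp (y * Complex.I) - 1) Λ :=
      hf.norm.mono' (by fun_prop) (ae_of_all _ fun p => norm_cexp_mul_I_sub_one_le (f p))
    have hmap := SimpleFunc.map_integral f (fun y : ℝ => Complex.exp (y * Complex.I) - 1) hf
      (by simp)
    rw [SimpleFunc.integral_eq_integral _ hg, ← Finset.sum_coe_sort] at hmap
    simpa only [Complex.real_smul, SimpleFunc.map_apply] using hmap
  rw [hΛ, ← h.integral_cexp_sum_apply (fun y : f.range => f.measurableSet_fiber y) hdisj
    fun y hy => SimpleFunc.measure_preimage_lt_top_of_integrable f hf hy]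
  exact integral_congr_ae (hN.mono fun ω hω => by simp only [hω])

lemma tendsto_integral_cexp_integral (h : IsPoissonRandomMeasure N Λ P)
    {f : ℕ → E → ℝ} {F bound : E → ℝ} (hf : ∀ n, Measurable (f n)) (hbound : Integrable bound Λ)
    (hle : ∀ n p, ‖f n p‖ ≤ bound p) (hlim : ∀ p, Tendsto (fun n => f n p) atTop (𝓝 (F p))) :
    Tendsto (fun n => ∫ ω, Complex.exp ((∫ p, f n p ∂N ω : ℝ) * Complex.I) ∂P) atTop
      (𝓝 (∫ ω, Complex.exp ((∫ p, F p ∂N ω : ℝ) * Complex.I) ∂P)) := by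
  have := h.isProbabilityMeasure
  refine tendsto_integral_of_dominated_convergence (fun _ => 1) (fun n => ?_)
    (integrable_const _) (fun n => ae_of_all _ fun ω => ?_) ?_
  · have := h.aemeasurable_integral
      (hbound.mono' (hf n).aestronglyMeasurable (ae_of_all _ (hle n)))
    exact (by fun_prop : AEMeasurable _ P).aestronglyMeasurable
  · rw [Complex.norm_exp_ofReal_mul_I]
  · filter_upwards [h.ae_integrable hbound] with ω hω
    have hint : Tendsto (fun n => ∫ p, f n p ∂N ω) atTop (𝓝 (∫ p, F p ∂N ω)) :=
      tendsto_integral_of_dominated_convergence bound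
        (fun n => (hf n).aestronglyMeasurable) hω (fun n => ae_of_all _ (hle n))
        (ae_of_all _ hlim)
    exact (Continuous.tendsto (f := fun x : ℝ => Complex.exp (x * Complex.I))
      (by fun_prop) _).comp hint

lemma integral_cexp_integral_of_measurable (h : IsPoissonRandomMeasure N Λ P)
    (hFm : Measurable F) (hF : Integrable F Λ) :
    ∫ ω, Complex.exp ((∫ p, F p ∂N ω : ℝ) * Complex.I) ∂P
      = Complex.exp (∫ p, (Complex.exp (F p * Complex.I) - 1) ∂Λ) := by
  let f : ℕ → SimpleFunc E ℝ := SimpleFunc.approxOn F hFm Set.univ 0 (Set.mem_univ _)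
  have hle n p : ‖f n p‖ ≤ ‖F p‖ + ‖F p‖ := SimpleFunc.norm_approxOn_zero_le hFm _ p n
  have hbound : Integrable (fun p => ‖F p‖ + ‖F p‖) Λ := hF.norm.add hF.norm
  have hlim p : Tendsto (fun n => f n p) atTop (𝓝 (F p)) :=
    SimpleFunc.tendsto_approxOn hFm _ (by simp)
  have hΛ : Tendsto (fun n => ∫ p, (Complex.exp (f n p * Complex.I) - 1) ∂Λ) atTop
      (𝓝 (∫ p, (Complex.exp (F p * Complex.I) - 1) ∂Λ)) := by
    refine tendsto_integral_of_dominated_convergence _ (fun n => by fun_prop) hbound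
      (fun n => ae_of_all _ fun p => (norm_cexp_mul_I_sub_one_le _).trans (hle n p))
      (ae_of_all _ fun p => ?_)
    exact (Continuous.tendsto (f := fun x : ℝ => Complex.exp (x * Complex.I) - 1)
      (by fun_prop) _).comp (hlim p)
  refine tendsto_nhds_unique
    (h.tendsto_integral_cexp_integral (fun n => (f n).measurable) hbound hle hlim) ?_
  have hf n : Integrable (f n) Λ := hbound.mono' (by fun_prop) (ae_of_all _ (hle n))
  simp only [fun n => h.integral_cexp_integral_simpleFunc (f n) (hf n)]
  exact (Complex.continuous_exp.tendsto _).comp hΛ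

lemma integral_cexp_integral (h : IsPoissonRandomMeasure N Λ P) (hF : Integrable F Λ) :
    ∫ ω, Complex.exp ((∫ p, F p ∂N ω : ℝ) * Complex.I) ∂P
      = Complex.exp (∫ p, (Complex.exp (F p * Complex.I) - 1) ∂Λ) := by
  have hmk := hF.1.ae_eq_mk
  calc ∫ ω, Complex.exp ((∫ p, F p ∂N ω : ℝ) * Complex.I) ∂P
      = ∫ ω, Complex.exp ((∫ p, hF.1.mk F p ∂N ω : ℝ) * Complex.I) ∂P :=
        integral_congr_ae ((h.ae_ae hmk).mono fun ω hω => by simp only [integral_congr_ae hω])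
    _ = Complex.exp (∫ p, (Complex.exp (hF.1.mk F p * Complex.I) - 1) ∂Λ) :=
        h.integral_cexp_integral_of_measurable hF.1.stronglyMeasurable_mk.measurable
          (hF.congr hmk)
    _ = Complex.exp (∫ p, (Complex.exp (F p * Complex.I) - 1) ∂Λ) := by
        congr 1
        exact integral_congr_ae (hmk.mono fun p hp => by simp only [hp])

lemma integral_cexp_compensated_integral (h : IsPoissonRandomMeasure N Λ P) (hF : Integrable F Λ) :
    ∫ ω, Complex.exp ((∫ p, F p ∂N ω - ∫ p, F p ∂Λ : ℝ) * Complex.I) ∂P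
      = Complex.exp (∫ p, cexpRemainder (F p) ∂Λ) := by
  have hFm := hF.1.aemeasurable
  have hexp : Integrable (fun p => Complex.exp (F p * Complex.I) - 1) Λ :=
    hF.norm.mono' (by fun_prop : AEMeasurable _ Λ).aestronglyMeasurable
      (ae_of_all _ fun p => norm_cexp_mul_I_sub_one_le (F p))
  have hlin : Integrable (fun p => (F p : ℂ) * Complex.I) Λ := hF.ofReal.mul_const _
  have hΛ : ∫ p, cexpRemainder (F p) ∂Λ
      = ∫ p, (Complex.exp (F p * Complex.I) - 1) ∂Λ - (∫ p, F p ∂Λ : ℝ) * Complex.I := by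
    simp only [cexpRemainder]
    rw [integral_sub hexp hlin, integral_mul_const, integral_complex_ofReal]
  rw [hΛ, Complex.exp_sub, ← h.integral_cexp_integral hF, ← integral_div]
  simp only [Complex.ofReal_sub, sub_mul, Complex.exp_sub]

end IsPoissonRandomMeasure

end PoissonRandomMeasures

section GaussianLaws

lemma hasGaussianLaw_comp_of_isGaussianProcess {S K Ω E : Type*} [Finite K] [MeasurableSpace Ω]
    [NormedAddCommGroup E] [NormedSpace ℝ E] [MeasurableSpace E] [BorelSpace E]
    [SecondCountableTopology E] {X : S → Ω → E} {P : Measure Ω} (hX : IsGaussianProcess X P)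
    (a : K → S) : HasGaussianLaw (fun ω k => X (a k) ω) P := by
  have := Fintype.ofFinite K
  exact ((hX.comp_right a).hasGaussianLaw Finset.univ).map_fun
    (.pi fun k => .proj (⟨k, Finset.mem_univ k⟩ : (Finset.univ : Finset K)))

lemma integral_cexp_of_hasGaussianLaw {Ω : Type*} [MeasurableSpace Ω] {Q : Measure Ω}
    {X : Ω → ℝ} (hX : HasGaussianLaw X Q) (hmean : ∫ ω, X ω ∂Q = 0) :
    ∫ ω, Complex.exp (X ω * Complex.I) ∂Q = Complex.exp (-(Var[X; Q] : ℂ) / 2) := by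
  have hchar := hX.charFun_map_eq 1
  rw [charFun_apply_real, integral_map hX.aemeasurable (by fun_prop)] at hchar
  simpa [hmean, neg_div] using hchar

end GaussianLaws

section Fluctuations

variable {E : Type*} [MeasurableSpace E] {μ ν : Measure E} {K : Type*} [Fintype K]

/-- The fluctuation `ε^{-1/2} (ε ∫ F dν - ∫ F dμ)` of the rescaled measure `ε ν` around `μ`,
tested against `F`. -/
noncomputable def fluctuation (μ ν : Measure E) (ε : ℝ) (F : E → ℝ) : ℝ :=
  ε ^ (-(1 / 2) : ℝ) * (ε * ∫ p, F p ∂ν - ∫ p, F p ∂μ)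

lemma fluctuation_sum {ε : ℝ} {F : K → E → ℝ} (hμ : ∀ k, Integrable (F k) μ)
    (hν : ∀ k, Integrable (F k) ν) (w : K → ℝ) :
    fluctuation μ ν ε (fun p => ∑ k, w k * F k p) = ∑ k, w k * fluctuation μ ν ε (F k) := by
  rw [fluctuation, integral_finsetSum _ fun k _ => (hμ k).const_mul _,
    integral_finsetSum _ fun k _ => (hν k).const_mul _, Finset.mul_sum, ← Finset.sum_sub_distrib,
    Finset.mul_sum]
  refine Finset.sum_congr rfl fun k _ => ?_
  rw [integral_const_mul, integral_const_mul, fluctuation]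
  ring

lemma fluctuation_eq_compensated_integral {ε : ℝ} (hε : 0 < ε) (F : E → ℝ) :
    fluctuation μ ν ε F
      = ∫ p, √ε * F p ∂ν - ∫ p, √ε * F p ∂(ENNReal.ofReal ε⁻¹ • μ) := by
  have hpow : ε ^ (-(1 / 2) : ℝ) = √ε / ε := by
    rw [Real.rpow_neg hε.le, ← Real.sqrt_eq_rpow, Real.sqrt_div_self', one_div]
  rw [fluctuation, hpow, integral_smul_measure, integral_const_mul, integral_const_mul,
    ENNReal.toReal_ofReal (inv_nonneg.2 hε.le), smul_eq_mul]
  field_simp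

lemma IsPoissonRandomMeasure.integral_cexp_fluctuation {Ω : Type*} [MeasurableSpace Ω]
    {N : Ω → Measure E} {P : Measure Ω} {ε : ℝ}
    (h : IsPoissonRandomMeasure N (ENNReal.ofReal ε⁻¹ • μ) P) (hε : 0 < ε) {F : E → ℝ}
    (hF : Integrable F μ) :
    ∫ ω, Complex.exp (fluctuation μ (N ω) ε F * Complex.I) ∂P
      = Complex.exp (∫ p, cexpRemainder (√ε * F p) / ε ∂μ) := by
  have hF' := (hF.const_mul √ε).smul_measure (ENNReal.ofReal_ne_top (r := ε⁻¹))
  simp only [fluctuation_eq_compensated_integral hε, h.integral_cexp_compensated_integral hF']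
  rw [integral_smul_measure, integral_div, ENNReal.toReal_ofReal (inv_nonneg.2 hε.le),
    Complex.real_smul, Complex.ofReal_inv, div_eq_inv_mul]

lemma variance_sum_eq_integral_sq {Ω : Type*} [MeasurableSpace Ω] {Q : Measure Ω}
    [IsFiniteMeasure Q] {Z : K → Ω → ℝ} (hZ : ∀ k, MemLp (Z k) 2 Q) {F : K → E → ℝ}
    (hF : ∀ k, MemLp (F k) 2 μ) (hcov : ∀ k l, cov[Z k, Z l; Q] = ∫ p, F k p * F l p ∂μ)
    (w : K → ℝ) :
    Var[fun ω => ∑ k, w k * Z k ω; Q] = ∫ p, (∑ k, w k * F k p) ^ 2 ∂μ := by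
  have hZw k : MemLp (fun ω => w k * Z k ω) 2 Q := (hZ k).const_mul _
  have hFw k l : Integrable (fun p => w k * F k p * (w l * F l p)) μ :=
    ((hF k).const_mul _).integrable_mul ((hF l).const_mul _)
  rw [← covariance_self (memLp_finsetSum _ fun k _ => hZw k).aemeasurable,
    covariance_fun_sum_fun_sum hZw hZw]
  simp only [sq, Finset.sum_mul_sum]
  rw [integral_finsetSum _ fun k _ => integrable_finsetSum _ fun l _ => hFw k l]
  refine Finset.sum_congr rfl fun k _ => ?_
  rw [integral_finsetSum _ fun l _ => hFw k l]
  refine Finset.sum_congr rfl fun l _ => ?_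
  rw [covariance_const_mul_left, covariance_const_mul_right, hcov, ← integral_const_mul,
    ← integral_const_mul]
  congr 1 with p
  ring

lemma integral_cexp_sum_of_hasGaussianLaw {Ω : Type*} [MeasurableSpace Ω] {Q : Measure Ω}
    {Z : K → Ω → ℝ} (hZ : HasGaussianLaw (fun ω k => Z k ω) Q) (hmean : ∀ k, ∫ ω, Z k ω ∂Q = 0)
    {F : K → E → ℝ} (hF : ∀ k, MemLp (F k) 2 μ)
    (hcov : ∀ k l, cov[Z k, Z l; Q] = ∫ p, F k p * F l p ∂μ) (w : K → ℝ) :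
    ∫ ω, Complex.exp ((∑ k, w k * Z k ω : ℝ) * Complex.I) ∂Q
      = Complex.exp (-((∫ p, (∑ k, w k * F k p) ^ 2 ∂μ : ℝ) : ℂ) / 2) := by
  have := hZ.isProbabilityMeasure
  have hL2 k : MemLp (Z k) 2 Q := (hZ.eval k).memLp_two
  have hsum : HasGaussianLaw (fun ω => ∑ k, w k * Z k ω) Q := by
    have := hZ.map_fun (∑ k, w k • ContinuousLinearMap.proj (R := ℝ) (φ := fun _ : K => ℝ) k)
    simpa using this
  have hsum_mean : ∫ ω, ∑ k, w k * Z k ω ∂Q = 0 := by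
    rw [integral_finsetSum _ fun k _ => ((hL2 k).integrable one_le_two).const_mul _]
    simp only [integral_const_mul, hmean, mul_zero, Finset.sum_const_zero]
  rw [integral_cexp_of_hasGaussianLaw hsum hsum_mean, variance_sum_eq_integral_sq hL2 hF hcov]

end Fluctuations

theorem tendstoInDistribution_fluctuation {E : Type*} [MeasurableSpace E] {μ : Measure E}
    {T : Type*} {l : Filter T} [l.IsCountablyGenerated] {ε : T → ℝ} (hε : ∀ i, 0 < ε i)
    (hεl : Tendsto ε l (𝓝 0)) {Ω : T → Type*} [∀ i, MeasurableSpace (Ω i)]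
    {P : ∀ i, Measure (Ω i)} [∀ i, IsProbabilityMeasure (P i)] {N : ∀ i, Ω i → Measure E}
    (hN : ∀ i, IsPoissonRandomMeasure (N i) (ENNReal.ofReal (ε i)⁻¹ • μ) (P i))
    {Ω' : Type*} [MeasurableSpace Ω'] {Q : Measure Ω'} [IsProbabilityMeasure Q]
    {K : Type*} [Finite K] {F : K → E → ℝ} (hF : ∀ k, Integrable (F k) μ)
    (hF2 : ∀ k, MemLp (F k) 2 μ) {Z : K → Ω' → ℝ} (hZ : HasGaussianLaw (fun ω k => Z k ω) Q)
    (hmean : ∀ k, ∫ ω, Z k ω ∂Q = 0) (hcov : ∀ k l, cov[Z k, Z l; Q] = ∫ p, F k p * F l p ∂μ) :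
    TendstoInDistribution (fun i ω k => fluctuation μ (N i ω) (ε i) (F k)) l
      (fun ω k => Z k ω) P Q := by
  have := Fintype.ofFinite K
  have hFΛ i k := (hF k).smul_measure (ENNReal.ofReal_ne_top (r := (ε i)⁻¹))
  have hmeas i : AEMeasurable (fun ω k => fluctuation μ (N i ω) (ε i) (F k)) (P i) := by
    refine aemeasurable_pi_lambda _ fun k => ?_
    have := (hN i).aemeasurable_integral (hFΛ i k)
    unfold fluctuation
    fun_prop
  refine tendstoInDistribution_of_tendsto_integral_cexp hmeas hZ.aemeasurable fun w => ?_
  have hexp i : ∫ ω, Complex.exp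
        ((∑ k, w k * fluctuation μ (N i ω) (ε i) (F k) : ℝ) * Complex.I) ∂P i
      = Complex.exp (∫ p, cexpRemainder (√(ε i) * ∑ k, w k * F k p) / ε i ∂μ) := by
    rw [← (hN i).integral_cexp_fluctuation (hε i)
      (integrable_finsetSum _ fun k _ => (hF k).const_mul (w k))]
    refine integral_congr_ae ?_
    filter_upwards [ae_all_iff.2 fun k => (hN i).ae_integrable (hFΛ i k)] with ω hω
    rw [fluctuation_sum hF hω]
  simp only [hexp, integral_cexp_sum_of_hasGaussianLaw hZ hmean hF2 hcov]
  have hε0 : Tendsto ε l (𝓝[>] 0) := tendsto_nhdsWithin_iff.2 ⟨hεl, .of_forall hε⟩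
  have hsum2 := memLp_finsetSum Finset.univ fun k _ => (hF2 k).const_mul (w k)
  exact (Complex.continuous_exp.tendsto _).comp
    ((tendsto_integral_cexpRemainder_sqrt_mul_div hsum2).comp hε0)

section Indicators

variable {α R : Type*} [LinearOrder α] [Ring R] {a b x : α}

lemma indicator_Ico_sub_indicator_Ico (a b x : α) :
    (Set.Ico a b).indicator (1 : α → R) x - (Set.Ico b a).indicator 1 x
      = (Set.Iio b).indicator 1 x - (Set.Iio a).indicator 1 x := by
  rcases lt_or_ge x a with ha | ha <;> rcases lt_or_ge x b with hb | hb <;>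
    simp [ha, hb, not_le.2, not_lt.2]

lemma indicator_Ioo_sub_indicator_Ioo (ha : x ≠ a) (hb : x ≠ b) :
    (Set.Ioo a b).indicator (1 : α → R) x - (Set.Ioo b a).indicator 1 x
      = (Set.Iio b).indicator 1 x - (Set.Iio a).indicator 1 x := by
  rw [← indicator_Ico_sub_indicator_Ico]
  simp only [Set.indicator_apply, Set.mem_Ioo, Set.mem_Ico, ha.symm.le_iff_lt, hb.symm.le_iff_lt]

lemma sq_indicator_Iio_sub_indicator_Iio (ha : x ≠ a) (hb : x ≠ b) :
    ((Set.Iio b).indicator (1 : α → R) x - (Set.Iio a).indicator 1 x) ^ 2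
      = (Set.uIcc a b).indicator 1 x := by
  rcases ha.lt_or_gt with ha | ha <;> rcases hb.lt_or_gt with hb | hb <;>
    simp [Set.mem_uIcc, ha, hb, ha.le, hb.le, ha.not_gt, hb.not_gt, ha.not_ge, hb.not_ge]

end Indicators

section Crossings

variable {μ ν : Measure Particle} {a b : ℝ × ℝ} {x v t : ℝ}

/-- The position at time `0` of the line of velocity `v` through the space-time point `a`: the
line `ℓ(x, v)` passes to the left of `a` exactly when `x < initialPosition a v`. -/
def initialPosition (a : ℝ × ℝ) (v : ℝ) : ℝ := a.1 - v * a.2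

@[fun_prop]
lemma measurable_initialPosition (a : ℝ × ℝ) : Measurable (initialPosition a) := by
  unfold initialPosition
  fun_prop

lemma mem_line_iff (a : ℝ × ℝ) (x v : ℝ) : a ∈ line x v ↔ initialPosition a v = x := by
  simp only [line, Set.mem_range, initialPosition, Prod.ext_iff, exists_eq_right,
    sub_eq_iff_eq_add]
  exact eq_comm

lemma image_initialPosition_segment (a b : ℝ × ℝ) (v : ℝ) :
    (initialPosition · v) '' segment ℝ a b
      = Set.uIcc (initialPosition a v) (initialPosition b v) := by
  rw [← segment_eq_uIcc]
  exact image_segment ℝ (LinearMap.fst ℝ ℝ ℝ - v • LinearMap.snd ℝ ℝ ℝ).toAffineMap a b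

lemma crossing_eq (a b : ℝ × ℝ) : crossing a b =
    {p | p.1 ∈ Set.uIcc (initialPosition a p.2.1) (initialPosition b p.2.1)} := by
  ext p
  rw [Set.mem_ofPred_eq, ← image_initialPosition_segment, Set.mem_image]
  simp only [crossing, Set.mem_ofPred_eq, Set.Nonempty, Set.mem_inter_iff, mem_line_iff,
    and_comm]

lemma measurableSet_crossing (a b : ℝ × ℝ) : MeasurableSet (crossing a b) := by
  simp only [crossing_eq, Set.uIcc, Set.mem_Icc]
  exact (measurableSet_le (by fun_prop) measurable_fst).inter
    (measurableSet_le measurable_fst (by fun_prop))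

lemma IsAdmissible.measure_crossing_lt_top (hμ : IsAdmissible μ) (a b : ℝ × ℝ) :
    μ (crossing a b) < ∞ :=
  le_self_add.trans_lt (hμ a b)

lemma IsAdmissible.secondMark_crossing_lt_top (hμ : IsAdmissible μ) (a b : ℝ × ℝ) :
    secondMark μ (crossing a b) < ∞ :=
  le_add_self.trans_lt (hμ a b)

lemma secondMark_crossing (μ : Measure Particle) (a b : ℝ × ℝ) :
    secondMark μ (crossing a b) = ∫⁻ p in crossing a b, ENNReal.ofReal (p.2.2 ^ 2) ∂μ :=
  withDensity_apply _ (measurableSet_crossing a b)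

/-- The mark of `p`, counted with sign, if the line of `p` separates `a` from `b`: positive when
the line passes to the right of `a` and to the left of `b`. -/
noncomputable def signedMark (a b : ℝ × ℝ) (p : Particle) : ℝ :=
  p.2.2 * ((Set.Iio (initialPosition b p.2.1)).indicator 1 p.1
    - (Set.Iio (initialPosition a p.2.1)).indicator 1 p.1)

lemma signedMark_add_signedMark (a b c : ℝ × ℝ) (p : Particle) :
    signedMark a b p + signedMark b c p = signedMark a c p := by
  unfold signedMark
  ring

lemma signedMark_eq_zero_of_notMem_crossing {p : Particle} (hp : p ∉ crossing a b) :
    signedMark a b p = 0 := by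
  rw [signedMark, ← indicator_Ico_sub_indicator_Ico, Set.indicator_of_notMem,
    Set.indicator_of_notMem, sub_zero, mul_zero]
  all_goals
    rw [crossing_eq] at hp
    refine mt (fun h => ?_) hp
  · exact Set.Icc_subset_uIcc' (Set.Ico_subset_Icc_self h)
  · exact Set.Icc_subset_uIcc (Set.Ico_subset_Icc_self h)

lemma support_signedMark_subset (a b : ℝ × ℝ) :
    Function.support (signedMark a b) ⊆ crossing a b :=
  Function.support_subset_iff'.2 fun _ => signedMark_eq_zero_of_notMem_crossing

lemma abs_signedMark_le (a b : ℝ × ℝ) (p : Particle) : |signedMark a b p| ≤ |p.2.2| := by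
  simp only [signedMark, Set.indicator_apply]
  split_ifs <;> simp

@[fun_prop]
lemma measurable_signedMark (a b : ℝ × ℝ) : Measurable (signedMark a b) := by
  have hIio (c : ℝ × ℝ) : Measurable fun p : Particle =>
      (Set.Iio (initialPosition c p.2.1)).indicator (1 : ℝ → ℝ) p.1 :=
    Measurable.ite (measurableSet_lt measurable_fst (by fun_prop)) measurable_const
      measurable_const
  have := hIio a
  have := hIio b
  unfold signedMark
  fun_prop

lemma IsAdmissible.memLp_signedMark (hμ : IsAdmissible μ) (a b : ℝ × ℝ) :
    MemLp (signedMark a b) 2 μ := by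
  have hmark : MemLp (fun p : Particle => p.2.2) 2 (μ.restrict (crossing a b)) := by
    rw [memLp_two_iff_integrable_sq (by fun_prop)]
    refine ⟨by fun_prop, ?_⟩
    rw [hasFiniteIntegral_iff_ofReal (ae_of_all _ fun p => sq_nonneg _), ← secondMark_crossing]
    exact hμ.secondMark_crossing_lt_top a b
  rw [← Set.indicator_eq_self.2 (support_signedMark_subset a b),
    memLp_indicator_iff_restrict (measurableSet_crossing a b)]
  exact hmark.mono (by fun_prop) (ae_of_all _ (abs_signedMark_le a b))

lemma IsAdmissible.integrable_signedMark (hμ : IsAdmissible μ) (a b : ℝ × ℝ) :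
    Integrable (signedMark a b) μ := by
  rw [← integrableOn_iff_integrable_of_support_subset (support_signedMark_subset a b)]
  have : IsFiniteMeasure (μ.restrict (crossing a b)) :=
    ⟨by simpa using hμ.measure_crossing_lt_top a b⟩
  exact ((hμ.memLp_signedMark a b).restrict _).integrable one_le_two

/-- `ν`-almost every particle whose line passes through `a` has mark zero. -/
def IsMarkless (ν : Measure Particle) (a : ℝ × ℝ) : Prop :=
  ∀ᵐ p ∂ν, p.1 = initialPosition a p.2.1 → p.2.2 = 0

lemma IsAdmissible.isMarkless (hμ : IsAdmissible μ) (ha : crossingDist μ a a = 0) :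
    IsMarkless μ a := by
  have hzero : secondMark μ (crossing a a) = 0 :=
    ((ENNReal.toReal_eq_zero_iff _).1 ha).resolve_right (hμ.secondMark_crossing_lt_top a a).ne
  rw [secondMark_crossing, lintegral_eq_zero_iff (by fun_prop), EventuallyEq,
    ae_restrict_iff' (measurableSet_crossing a a)] at hzero
  filter_upwards [hzero] with p hp hpa
  have hsq : ENNReal.ofReal (p.2.2 ^ 2) = 0 := hp (by simp [crossing_eq, hpa])
  exact sq_eq_zero_iff.1 ((ENNReal.ofReal_eq_zero.1 hsq).antisymm (sq_nonneg _))

lemma sq_signedMark_ae_eq (ha : IsMarkless μ a) (hb : IsMarkless μ b) :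
    (fun p => signedMark a b p ^ 2) =ᵐ[μ] (crossing a b).indicator fun p => p.2.2 ^ 2 := by
  filter_upwards [ha, hb] with p hpa hpb
  by_cases hr : p.2.2 = 0
  · simp only [signedMark, Set.indicator, hr, zero_mul, zero_pow two_ne_zero, ite_self]
  · rw [signedMark, mul_pow, sq_indicator_Iio_sub_indicator_Iio (mt hpa hr) (mt hpb hr),
      crossing_eq]
    by_cases hp : p.1 ∈ Set.uIcc (initialPosition a p.2.1) (initialPosition b p.2.1) <;>
      simp [hp]

lemma crossingDist_eq_integral (ha : IsMarkless μ a) (hb : IsMarkless μ b) :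
    crossingDist μ a b = ∫ p, signedMark a b p ^ 2 ∂μ := by
  rw [integral_congr_ae (sq_signedMark_ae_eq ha hb),
    integral_indicator (measurableSet_crossing a b),
    integral_eq_lintegral_of_nonneg_ae (ae_of_all _ fun p => sq_nonneg _) (by fun_prop),
    ← secondMark_crossing, crossingDist]

lemma IsAdmissible.integral_signedMark_mul_signedMark (hμ : IsAdmissible μ) {o : ℝ × ℝ}
    (ho : IsMarkless μ o) (ha : IsMarkless μ a) (hb : IsMarkless μ b) :
    ∫ p, signedMark o a p * signedMark o b p ∂μ
      = (crossingDist μ o a + crossingDist μ o b - crossingDist μ a b) / 2 := by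
  have hsq c d : Integrable (fun p => signedMark c d p ^ 2) μ :=
    (hμ.memLp_signedMark c d).integrable_sq
  rw [crossingDist_eq_integral ho ha, crossingDist_eq_integral ho hb,
    crossingDist_eq_integral ha hb, ← integral_add (hsq _ _) (hsq _ _),
    ← integral_sub (by fun_prop) (hsq _ _), ← integral_div]
  congr 1 with p
  rw [← signedMark_add_signedMark o a b]
  ring

lemma mass_zero_eq_integral_signedMark (ν : Measure Particle) (x : ℝ) :
    mass ν 0 x = ∫ p, signedMark 0 (x, 0) p ∂ν := by
  simp only [mass, indicator_Ico_sub_indicator_Ico, signedMark, initialPosition, Prod.fst_zero,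
    Prod.snd_zero, mul_zero, sub_zero]

lemma signedMark_freeMotion (x y t : ℝ) (p : Particle) :
    signedMark (x, 0) (y, 0) (freeMotion t p) = signedMark (x, t) (y, t) p := by
  simp [signedMark, initialPosition, freeMotion, Set.indicator_apply, lt_sub_iff_add_lt]

lemma mass_evolve_zero_eq_integral_signedMark (ν : Measure Particle) (t x : ℝ) :
    mass (evolve t ν) 0 x = ∫ p, signedMark (0, t) (x, t) p ∂ν := by
  have hmeas : Measurable (freeMotion t) := by
    unfold freeMotion
    fun_prop
  rw [mass_zero_eq_integral_signedMark, evolve, integral_map hmeas.aemeasurable (by fun_prop)]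
  exact integral_congr_ae (ae_of_all _ (signedMark_freeMotion 0 x t))

lemma mass_evolve_zero_eq_sub (ht : Integrable (signedMark 0 (0, t)) ν)
    (hx : Integrable (signedMark 0 (x, t)) ν) :
    mass (evolve t ν) 0 x
      = ∫ p, signedMark 0 (x, t) p ∂ν - ∫ p, signedMark 0 (0, t) p ∂ν := by
  rw [mass_evolve_zero_eq_integral_signedMark, ← integral_sub hx ht]
  congr 1 with p
  rw [← signedMark_add_signedMark 0 (0, t) (x, t), add_sub_cancel_left]

lemma flow_eq_integral_signedMark (h₀ : IsMarkless ν (x, 0))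
    (h₁ : IsMarkless ν (x + v * t, t)) :
    flow ν x v t = ∫ p, signedMark (x, 0) (x + v * t, t) p ∂ν := by
  refine integral_congr_ae ?_
  filter_upwards [h₀, h₁] with p hp₀ hp₁
  by_cases hr : p.2.2 = 0
  · simp [signedMark, hr]
  · rw [signedMark, ← indicator_Ioo_sub_indicator_Ioo (mt hp₀ hr) (mt hp₁ hr)]
    simp only [Set.indicator_apply, Set.mem_ofPred_eq, Set.mem_Ioo, initialPosition, mul_zero,
      sub_zero, lt_sub_iff_add_lt, sub_lt_iff_lt_add, mul_comm t, and_comm, Pi.one_apply]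

lemma quasiParticle_eq_integral_signedMark (h₀ : IsMarkless ν (x, 0))
    (h₁ : IsMarkless ν (x + v * t, t)) (hi₀ : Integrable (signedMark 0 (x, 0)) ν)
    (hi₁ : Integrable (signedMark 0 (x + v * t, t)) ν) :
    quasiParticle ν x v t = x + v * t + ∫ p, signedMark 0 (x + v * t, t) p ∂ν := by
  have hflow : flow ν x v t = ∫ p, signedMark 0 (x + v * t, t) p ∂ν
      - ∫ p, signedMark 0 (x, 0) p ∂ν := by
    rw [flow_eq_integral_signedMark h₀ h₁, ← integral_sub hi₁ hi₀]
    congr 1 with p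
    rw [← signedMark_add_signedMark 0 (x, 0), add_sub_cancel_left]
  rw [quasiParticle, mass_zero_eq_integral_signedMark, hflow]
  ring

lemma IsMarkless.rescale (ha : IsMarkless ν a) (ε : ℝ) : IsMarkless (rescale ε ν) a :=
  Measure.smul_absolutelyContinuous.ae_le ha

lemma integral_rescale {ε : ℝ} (hε : 0 ≤ ε) (ν : Measure Particle) (F : Particle → ℝ) :
    ∫ p, F p ∂rescale ε ν = ε * ∫ p, F p ∂ν := by
  rw [rescale, integral_smul_measure, ENNReal.toReal_ofReal hε, smul_eq_mul]

end Crossings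

section PoissonParticles

variable {Ω : Type*} [MeasurableSpace Ω] {N : Ω → Measure Particle} {μ : Measure Particle}
  {P : Measure Ω} {c : ℝ≥0∞}

lemma IsPoissonRandomMeasure.ae_isMarkless (h : IsPoissonRandomMeasure N (c • μ) P) {a : ℝ × ℝ}
    (ha : IsMarkless μ a) : ∀ᵐ ω ∂P, IsMarkless (N ω) a :=
  h.ae_ae (Measure.smul_absolutelyContinuous.ae_le ha)

lemma IsPoissonRandomMeasure.ae_integrable_signedMark (h : IsPoissonRandomMeasure N (c • μ) P)
    (hc : c ≠ ∞) (hμ : IsAdmissible μ) (a b : ℝ × ℝ) :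
    ∀ᵐ ω ∂P, Integrable (signedMark a b) (N ω) :=
  h.ae_integrable ((hμ.integrable_signedMark a b).smul_measure hc)

lemma IsPoissonRandomMeasure.ae_quasiParticle_fluctuation_eq
    (h : IsPoissonRandomMeasure N (c • μ) P) (hc : c ≠ ∞) (hμ : IsAdmissible μ) {ε x v t : ℝ}
    (hε : 0 ≤ ε) (h₀ : IsMarkless μ (x, 0)) (h₁ : IsMarkless μ (x + v * t, t)) :
    ∀ᵐ ω ∂P, ε ^ (-(1 / 2) : ℝ) * (quasiParticle (rescale ε (N ω)) x v t - quasiParticle μ x v t)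
      = fluctuation μ (N ω) ε (signedMark 0 (x + v * t, t)) := by
  filter_upwards [h.ae_isMarkless h₀, h.ae_isMarkless h₁, h.ae_integrable_signedMark hc hμ 0 (x, 0),
    h.ae_integrable_signedMark hc hμ 0 (x + v * t, t)] with ω hω₀ hω₁ hi₀ hi₁
  rw [quasiParticle_eq_integral_signedMark (hω₀.rescale ε) (hω₁.rescale ε)
      (hi₀.smul_measure ENNReal.ofReal_ne_top) (hi₁.smul_measure ENNReal.ofReal_ne_top),
    quasiParticle_eq_integral_signedMark h₀ h₁ (hμ.integrable_signedMark _ _)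
      (hμ.integrable_signedMark _ _),
    integral_rescale hε, add_sub_add_left_eq_sub, fluctuation]

lemma IsPoissonRandomMeasure.ae_mass_evolve_fluctuation_eq
    (h : IsPoissonRandomMeasure N (c • μ) P) (hc : c ≠ ∞) (hμ : IsAdmissible μ) (ε x t : ℝ) :
    ∀ᵐ ω ∂P, ε ^ (-(1 / 2) : ℝ) * (ε * mass (evolve t (N ω)) 0 x - mass (evolve t μ) 0 x)
      = fluctuation μ (N ω) ε (signedMark 0 (x, t))
        - fluctuation μ (N ω) ε (signedMark 0 (0, t)) := by
  filter_upwards [h.ae_integrable_signedMark hc hμ 0 (0, t),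
    h.ae_integrable_signedMark hc hμ 0 (x, t)] with ω hi₀ hi₁
  rw [mass_evolve_zero_eq_sub hi₀ hi₁, mass_evolve_zero_eq_sub (hμ.integrable_signedMark _ _)
    (hμ.integrable_signedMark _ _), fluctuation, fluctuation]
  ring

end PoissonParticles

theorem tendstoInDistribution_fluctuation_signedMark {μ : Measure Particle} (hμ : IsAdmissible μ)
    (hd : ∀ a : ℝ × ℝ, crossingDist μ a a = 0)
    {T : Type*} {l : Filter T} [l.IsCountablyGenerated] {ε : T → ℝ} (hε : ∀ i, 0 < ε i)
    (hεl : Tendsto ε l (𝓝 0)) {Ω : T → Type*} [∀ i, MeasurableSpace (Ω i)]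
    {P : ∀ i, Measure (Ω i)} [∀ i, IsProbabilityMeasure (P i)] {N : ∀ i, Ω i → Measure Particle}
    (hN : ∀ i, IsPoissonRandomMeasure (N i) (ENNReal.ofReal (ε i)⁻¹ • μ) (P i))
    {Ω' : Type*} [MeasurableSpace Ω'] {Q : Measure Ω'} [IsProbabilityMeasure Q]
    {η : ℝ × ℝ → Ω' → ℝ} (hη : IsLevyChentsovField η (crossingDist μ) Q)
    {K : Type*} [Finite K] (a : K → ℝ × ℝ) :
    TendstoInDistribution (fun i ω k => fluctuation μ (N i ω) (ε i) (signedMark 0 (a k))) l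
      (fun ω k => η (a k) ω) P Q := by
  have hm c : IsMarkless μ c := hμ.isMarkless (hd c)
  refine tendstoInDistribution_fluctuation hε hεl hN (fun k => hμ.integrable_signedMark 0 (a k))
    (fun k => hμ.memLp_signedMark 0 (a k))
    (hasGaussianLaw_comp_of_isGaussianProcess hη.isGaussianProcess a)
    (fun k => hη.centered (a k)) fun k k' => ?_
  rw [hη.covariance_eq, hμ.integral_signedMark_mul_signedMark (hm 0) (hm _) (hm _)]

end HardRod

theorem mainTheorem4
    (μ : Measure Particle) (hμ : IsAdmissible μ)
    (hd : ∀ a : ℝ × ℝ, crossingDist μ a a = 0)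
    {Ω : Set.Ioi (0 : ℝ) → Type*} [∀ ε, MeasurableSpace (Ω ε)]
    (P : ∀ ε, Measure (Ω ε)) [∀ ε, IsProbabilityMeasure (P ε)]
    (N : ∀ ε, Ω ε → Measure Particle)
    (hN : ∀ ε, IsPoissonProcess (N ε) (ENNReal.ofReal (ε : ℝ)⁻¹ • μ) (P ε))
    {Ω' : Type*} [MeasurableSpace Ω'] (Q : Measure Ω') [IsProbabilityMeasure Q]
    (η : ℝ × ℝ → Ω' → ℝ) (hη : IsLevyChentsovField η (crossingDist μ) Q)
    {ι κ : Type*} [Fintype ι] [Fintype κ]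
    (x v t : ι → ℝ) (z s : κ → ℝ) :
    TendstoInDistribution
      (fun (ε : Set.Ioi (0 : ℝ)) (ω : Ω ε) =>
        ((fun i : ι => (ε : ℝ) ^ (-(1 / 2) : ℝ) *
            (quasiParticle (rescale ε (N ε ω)) (x i) (v i) (t i)
              - quasiParticle μ (x i) (v i) (t i))),
          (fun j : κ => (ε : ℝ) ^ (-(1 / 2) : ℝ) *
            (ε * mass (evolve (s j) (N ε ω)) 0 (z j) - mass (evolve (s j) μ) 0 (z j)))))
      (comap (Subtype.val : Set.Ioi (0 : ℝ) → ℝ) (𝓝 0))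
      (fun ω : Ω' =>
        ((fun i : ι => η (x i + v i * t i, t i) ω),
          (fun j : κ => η (z j, s j) ω - η (0, s j) ω)))
      P Q := by
  have hPoisson ε := (hN ε).isPoissonRandomMeasure
  have hmarkless a : IsMarkless μ a := hμ.isMarkless (hd a)
  let points : ι ⊕ κ ⊕ κ → ℝ × ℝ :=
    Sum.elim (fun i => (x i + v i * t i, t i)) (Sum.elim (fun j => (z j, s j)) fun j => (0, s j))
  let observe (y : ι ⊕ κ ⊕ κ → ℝ) : (ι → ℝ) × (κ → ℝ) :=
    (fun i => y (.inl i), fun j => y (.inr (.inl j)) - y (.inr (.inr j)))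
  have hfield := tendstoInDistribution_fluctuation_signedMark hμ hd (fun ε => ε.2)
    tendsto_comap hPoisson hη points
  refine (hfield.continuous_comp (g := observe) (by fun_prop)).congr (fun ε => ?_) .rfl
  filter_upwards [
    ae_all_iff.2 fun i => (hPoisson ε).ae_quasiParticle_fluctuation_eq ENNReal.ofReal_ne_top hμ
      ε.2.le (hmarkless (x i, 0)) (hmarkless (x i + v i * t i, t i)),
    ae_all_iff.2 fun j => (hPoisson ε).ae_mass_evolve_fluctuation_eq ENNReal.ofReal_ne_top hμ
      ε (z j) (s j)] with ω hposition hmass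
  exact Prod.ext (funext fun i => (hposition i).symm) (funext fun j => (hmass j).symm)
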